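/- Every $x\in(0,1]$ has a unique Lüroth expansion $$x=\sum_{k=1}^{\infty}\frac{1}{d_k\prod_{j=1}^{k-1}d_j(d_j-1)},\qquad d_k=d_k(x)\in\{2,3,4,\dots\},$$ whose digits are $d_1(x)=\lfloor 1/x\rfloor+1$ and $d_n(x)=d_1(T^{n-1}x)$, where $T:(0,1]\to(0,1]$, $T(x)=\lfloor 1/x\rfloor\left(\lfloor 1/x+1\rfloor x-1\right)$. For $n\ge 1$ put $$Q_n(x)=d_n\prod_{j=1}^{n-1}d_j(d_j-1),\qquad P_n(x)=Q_n(x)\sum_{k=1}^{n}\frac{1}{d_k\prod_{j=1}^{k-1}d_j(d_j-1)}.$$ Let $\mathbb{N}=\{1,2,3,\dots\}$. For $\psi:\mathbb{N}\to(0,1]$ let $$L(\psi)=\limsup_{n\to\infty}\left\{x\in(0,1]:\left|x-\frac{P_n(x)}{Q_n(x)}\right|<\frac{\psi(Q_n(x))}{Q_n(x)}\right\}$$ (the set of $x$ that satisfy the inequality for infinitely many $n$), and let $$\underline{\tau}_\psi=\liminf_{q\to\infty}-\frac{\log\psi(q)}{\log q},\qquad \overline{\tau}_\psi=\limsup_{q\to\infty}-\frac{\log\psi(q)}{\log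 q}$$ be the lower and upper orders at infinity of $1/\psi$, which are elements of $[0,+\infty]$. **Theorem 3.** For every $\psi:\mathbb{N}\to(0,1]$, $$\frac{1}{1+\overline{\tau}_\psi}\le\dim L(\psi)\le\frac{1}{1+\underline{\tau}_\psi},$$ where $\dim$ denotes Hausdorff dimension and $1/(1+\infty)=0$. -/

import Mathlib

noncomputable section

/-- The Lüroth map `T(x) = ⌊1/x⌋ (⌊1/x + 1⌋ x - 1)`, which maps `(0,1]` to itself. -/
def lurothMap (x : ℝ) : ℝ :=
  (⌊1 / x⌋ : ℝ) * ((⌊1 / x + 1⌋ : ℝ) * x - 1)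

/-- The Lüroth digits of `x ∈ (0,1]`, indexed from `0`:
`lurothDigit x k` is `d_{k+1}(x) = d_1(T^k x)`, where `d_1(y) = ⌊1/y⌋ + 1`. -/
def lurothDigit (x : ℝ) (k : ℕ) : ℕ :=
  ⌊1 / (lurothMap^[k] x)⌋₊ + 1

/-- The Lüroth convergents of `x`, indexed from `0`: `lurothConvergent x n` is the partial sum
`[d_1, …, d_{n+1}]` of the Lüroth expansion, with terms `1 / (d_k ∏_{j<k} d_j (d_j - 1))`. -/
def lurothConvergent (x : ℝ) (n : ℕ) : ℝ :=
  ∑ k ∈ Finset.range (n + 1),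
    1 / ((lurothDigit x k : ℝ) *
      ∏ j ∈ Finset.range k, (lurothDigit x j : ℝ) * ((lurothDigit x j : ℝ) - 1))

/-- The unsimplified denominator of the Lüroth convergents, indexed from `0`:
`lurothDen x n` is `Q_{n+1}(x) = d_{n+1} ∏_{j ≤ n} d_j (d_j - 1)`. All digits are at least `1`,
so the natural subtraction does not truncate. -/
def lurothDen (x : ℝ) (n : ℕ) : ℕ :=
  lurothDigit x n * ∏ j ∈ Finset.range n, lurothDigit x j * (lurothDigit x j - 1)

/-- The unsimplified numerator of the Lüroth convergents, indexed from `0`: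
`lurothNum x n` is `P_{n+1}(x) = [d_1, …, d_{n+1}] Q_{n+1}(x)`. -/
def lurothNum (x : ℝ) (n : ℕ) : ℝ :=
  lurothConvergent x n * (lurothDen x n : ℝ)

/-- The set `L(ψ)` of Lüroth `ψ`-well approximable numbers, as a limit superior of sets. -/
def lurothWellApproximable (ψ : ℕ → ℝ) : Set ℝ :=
  Filter.limsup
    (fun n : ℕ => {x : ℝ | x ∈ Set.Ioc (0 : ℝ) 1 ∧
      |x - lurothNum x n / (lurothDen x n : ℝ)| < ψ (lurothDen x n) / (lurothDen x n : ℝ)})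
    Filter.atTop

/-- The lower order at infinity of `1/ψ`, as an extended real number. -/
def lowerOrder (ψ : ℕ → ℝ) : EReal :=
  Filter.liminf (fun q : ℕ => ((-(Real.log (ψ q) / Real.log (q : ℝ)) : ℝ) : EReal)) Filter.atTop

/-- The upper order at infinity of `1/ψ`, as an extended real number. -/
def upperOrder (ψ : ℕ → ℝ) : EReal :=
  Filter.limsup (fun q : ℕ => ((-(Real.log (ψ q) / Real.log (q : ℝ)) : ℝ) : EReal)) Filter.atTop

end

open Filter Topology MeasureTheory Set

/-! Upper bound: let `τ` be below the lower order. The points of L(ψ) that satisfy the inequality at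
a given large index and have prescribed digits up to it lie to the right of one common convergent,
within Q^(-(1+τ)). These sets form covers, and the sum of Q^(-t) over all digit words is finite for
t > 1: the cylinder lengths 1/(d(d-1)) add up to 1, so the sum is a convergent geometric series
times ∑ d^(-t) over the last digit (`tsum_wordDen_rpow_ne_top`).

Lower bound: the convergents of arbitrary points with Q ≤ 2R are 1/R-dense from the left
(`exists_lurothDen_le`). A Jarník construction (`le_dimH_frequently_close`) then shows that the
points within R^(-(1+τ)) to the right of such fractions, for infinitely many R, have dimension at
least 1/(1+τ). Such a fraction need not be a convergent of the point itself, but convergents are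
best approximations from below (`exists_lurothConvergent_ge`), so one of its own, with no larger
denominator, is at least as close. -/

/-! ### Cantor sets parametrized by [0, 1) -/

/-- The inverse of `g` is `s`-Hölder and maps onto an interval of dimension 1, and an `s`-Hölder map
raises dimension by at most the factor 1/s. This replaces a mass distribution argument. -/
theorem le_dimH_of_holder_leftInverse {s C : NNReal} (hs : 0 < s) {E : Set ℝ} {g : ℝ → ℝ}
    (hE : ∀ y ∈ Ico (0 : ℝ) 1, g y ∈ E)
    (hg : ∀ y ∈ Ico (0 : ℝ) 1, ∀ z ∈ Ico (0 : ℝ) 1,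
      |y - z| ≤ C * |g y - g z| ^ (s : ℝ)) : (s : ENNReal) ≤ dimH E := by
  have hinj : InjOn g (Ico (0 : ℝ) 1) := by
    intro y hy z hz h
    have := hg y hy z hz
    rw [h, sub_self, abs_zero, Real.zero_rpow (by exact_mod_cast hs.ne'), mul_zero] at this
    exact sub_eq_zero.1 (abs_nonpos_iff.1 this)
  have hinv : LeftInvOn (Function.invFunOn g (Ico (0 : ℝ) 1)) g (Ico (0 : ℝ) 1) :=
    hinj.leftInvOn_invFunOn
  have hH : HolderOnWith C s (Function.invFunOn g (Ico (0 : ℝ) 1)) (g '' Ico (0 : ℝ) 1) := by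
    rintro _ ⟨y, hy, rfl⟩ _ ⟨z, hz, rfl⟩
    rw [hinv hy, hinv hz, edist_dist, edist_dist, Real.dist_eq, Real.dist_eq,
      ENNReal.ofReal_rpow_of_nonneg (abs_nonneg _) s.coe_nonneg]
    have h := ENNReal.ofReal_le_ofReal (hg y hy z hz)
    rwa [ENNReal.ofReal_mul C.coe_nonneg, ENNReal.ofReal_coe_nnreal] at h
  have h1 := hH.dimH_image_le hs
  rw [hinv.image_image, Real.dimH_of_nonempty_interior (by simp)] at h1
  have hs' : (s : ENNReal) ≠ 0 := by exact_mod_cast hs.ne'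
  have h2 : (s : ENNReal) ≤ dimH (g '' Ico (0 : ℝ) 1) := by
    simpa using (ENNReal.le_div_iff_mul_le (Or.inl hs') (Or.inl ENNReal.coe_ne_top)).1 h1
  exact h2.trans (dimH_mono (by rintro _ ⟨y, hy, rfl⟩; exact hE y hy))

/-- Data for a Cantor set in `[0, 1]` whose intervals of level `k` have length `ρ k` and left
endpoints `c k i` in cells `[i / R k, (i + 1) / R k)` of a grid. -/
structure CantorScheme where
  R : ℕ → ℕ
  m : ℕ → ℕ
  ρ : ℕ → ℝ
  c : ℕ → ℕ → ℝ
  R_pos : ∀ k, 0 < R k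
  two_le_m : ∀ k, 2 ≤ m k
  ρ_nonneg : ∀ k, 0 ≤ ρ k
  ρ_zero : ρ 0 = 1
  ρ_le : ∀ k, ρ k ≤ 1 / R k
  -- Each of the `m k` children uses three grid cells: the one with its left endpoint, one for its
  -- overhang, one as a gap.
  m_le : ∀ k, 3 * (m k : ℝ) ≤ ρ k * R (k + 1)
  le_c : ∀ k i, 1 ≤ i → i + 1 ≤ R k → (i : ℝ) / R k ≤ c k i
  c_lt : ∀ k i, 1 ≤ i → i + 1 ≤ R k → c k i < ((i : ℝ) + 1) / R k

namespace CantorScheme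

variable (S : CantorScheme)

/-- The left endpoint of the interval of level `k` with number `t`. -/
noncomputable def left (S : CantorScheme) : ℕ → ℕ → ℝ
  | 0, _ => 0
  | k + 1, t =>
    S.c (k + 1) (⌊(S.R (k + 1) : ℝ) * left S k (t / S.m k)⌋₊ + 1 + 3 * (t % S.m k))

/-- The grid cell of level `k + 1` from which the left endpoint number `t` is taken. -/
noncomputable def cell (S : CantorScheme) (k t : ℕ) : ℕ :=
  ⌊(S.R (k + 1) : ℝ) * S.left k (t / S.m k)⌋₊ + 1 + 3 * (t % S.m k)

/-- The number of intervals of level `k`. -/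
def count (S : CantorScheme) (k : ℕ) : ℕ := ∏ i ∈ Finset.range k, S.m i

theorem left_succ (k t : ℕ) : S.left (k + 1) t = S.c (k + 1) (S.cell k t) := rfl

theorem one_le_cell (k t : ℕ) : 1 ≤ S.cell k t := by unfold cell; omega

theorem R_pos' (k : ℕ) : (0 : ℝ) < S.R k := by exact_mod_cast S.R_pos k

/-- The summand 1 in `cell` skips the cell that holds the parent's left endpoint. The strictness
makes left endpoints increase strictly, so that points of the Cantor set avoid them. -/
theorem lt_cell (k t : ℕ) : S.left k (t / S.m k) < (S.cell k t : ℝ) / S.R (k + 1) := by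
  rw [lt_div_iff₀ (S.R_pos' _), mul_comm]
  refine (Nat.lt_floor_add_one _).trans_le ?_
  unfold cell
  push_cast
  have : (0 : ℝ) ≤ 3 * ((t % S.m k : ℕ) : ℝ) := by positivity
  linarith

theorem cell_add_le (k t : ℕ) (h0 : 0 ≤ S.left k (t / S.m k)) :
    ((S.cell k t : ℝ) + 2) / S.R (k + 1) ≤ S.left k (t / S.m k) + S.ρ k := by
  rw [div_le_iff₀ (S.R_pos' _)]
  have h1 : t % S.m k + 1 ≤ S.m k := Nat.mod_lt _ (by have := S.two_le_m k; omega)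
  have h1' : ((t % S.m k : ℕ) : ℝ) + 1 ≤ S.m k := by exact_mod_cast h1
  have h2 := S.m_le k
  have h3 := Nat.floor_le (mul_nonneg (S.R_pos' (k + 1)).le h0)
  have h4 : (S.cell k t : ℝ) = (⌊(S.R (k + 1) : ℝ) * S.left k (t / S.m k)⌋₊ : ℝ) + 1 +
      3 * ((t % S.m k : ℕ) : ℝ) := by
    unfold cell; push_cast; rfl
  rw [h4]
  nlinarith

/-- The bounds for the parent make the child's cell admissible for `le_c` and `c_lt`, which give the
bounds for the child; hence one joint induction. Level 0 has no cell, whence the quantified `j`. -/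
theorem left_bounds (k t : ℕ) : 0 ≤ S.left k t ∧ S.left k t + S.ρ k ≤ 1 ∧
    (∀ j, k = j + 1 → S.cell j t + 1 ≤ S.R k) := by
  induction k generalizing t with
  | zero => simp [left, S.ρ_zero]
  | succ k ih =>
    obtain ⟨h0, h1, -⟩ := ih (t / S.m k)
    have hlt := S.lt_cell k t
    have hle := S.cell_add_le k t h0
    have hR := S.R_pos' (k + 1)
    have hcell : S.cell k t + 1 ≤ S.R (k + 1) := by
      have := hle.trans h1
      rw [div_le_one hR] at this
      have h2 : S.cell k t + 2 ≤ S.R (k + 1) := by exact_mod_cast this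
      omega
    have hc1 := S.le_c (k + 1) _ (S.one_le_cell k t) hcell
    have hc2 := S.c_lt (k + 1) _ (S.one_le_cell k t) hcell
    refine ⟨?_, ?_, ?_⟩
    · rw [left_succ]; linarith
    · rw [left_succ]
      have h5 := S.ρ_le (k + 1)
      have : ((S.cell k t : ℝ) + 2) / S.R (k + 1) =
        ((S.cell k t : ℝ) + 1) / S.R (k + 1) + 1 / S.R (k + 1) := by ring
      linarith
    · rintro j hj
      obtain rfl : k = j := by omega
      exact hcell

theorem cell_add_one_le (k t : ℕ) : S.cell k t + 1 ≤ S.R (k + 1) :=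
  (S.left_bounds (k + 1) t).2.2 k rfl

theorem cell_le_left (k t : ℕ) : (S.cell k t : ℝ) / S.R (k + 1) ≤ S.left (k + 1) t :=
  S.le_c _ _ (S.one_le_cell k t) (S.cell_add_one_le k t)

theorem left_lt_cell (k t : ℕ) : S.left (k + 1) t < ((S.cell k t : ℝ) + 1) / S.R (k + 1) :=
  S.c_lt _ _ (S.one_le_cell k t) (S.cell_add_one_le k t)

theorem left_lt_left_succ (k t : ℕ) : S.left k (t / S.m k) < S.left (k + 1) t :=
  (S.lt_cell k t).trans_le (S.cell_le_left k t)

theorem right_succ_le (k t : ℕ) :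
    S.left (k + 1) t + S.ρ (k + 1) ≤ S.left k (t / S.m k) + S.ρ k := by
  have h1 := S.cell_add_le k t (S.left_bounds k _).1
  have h2 := S.left_lt_cell k t
  have h3 := S.ρ_le (k + 1)
  have : ((S.cell k t : ℝ) + 2) / S.R (k + 1) =
    ((S.cell k t : ℝ) + 1) / S.R (k + 1) + 1 / S.R (k + 1) := by ring
  linarith

theorem count_succ (k : ℕ) : S.count (k + 1) = S.count k * S.m k :=
  Finset.prod_range_succ _ _

theorem two_pow_le_count (k : ℕ) : 2 ^ k ≤ S.count k := by
  induction k with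
  | zero => simp [count]
  | succ k ih => rw [count_succ, pow_succ]; exact Nat.mul_le_mul ih (S.two_le_m k)

theorem count_pos (k : ℕ) : (0 : ℝ) < S.count k := by
  exact_mod_cast (Nat.two_pow_pos k).trans_le (S.two_pow_le_count k)

/-- The number of the interval of level `k` that corresponds to `y ∈ [0, 1)`. -/
noncomputable def index (S : CantorScheme) (k : ℕ) (y : ℝ) : ℕ := ⌊(S.count k : ℝ) * y⌋₊

theorem index_succ_div (k : ℕ) (y : ℝ) : S.index (k + 1) y / S.m k = S.index k y := by
  have hm : (S.m k : ℝ) ≠ 0 := by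
    have := S.two_le_m k
    positivity
  unfold index
  rw [← Nat.floor_div_natCast, count_succ]
  congr 1
  push_cast
  field_simp

/-- The point of the Cantor set that corresponds to `y ∈ [0, 1)`. -/
noncomputable def point (S : CantorScheme) (y : ℝ) : ℝ := ⨆ k, S.left k (S.index k y)

theorem strictMono_left_index (y : ℝ) : StrictMono fun k => S.left k (S.index k y) := by
  refine strictMono_nat_of_lt_succ fun k => ?_
  have := S.left_lt_left_succ k (S.index (k + 1) y)
  rwa [index_succ_div] at this

theorem antitone_right_index (y : ℝ) : Antitone fun k => S.left k (S.index k y) + S.ρ k := by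
  refine antitone_nat_of_succ_le fun k => ?_
  have := S.right_succ_le k (S.index (k + 1) y)
  rwa [index_succ_div] at this

theorem left_le_right (y : ℝ) (j k : ℕ) :
    S.left j (S.index j y) ≤ S.left k (S.index k y) + S.ρ k := by
  have h1 := (S.strictMono_left_index y).monotone (le_max_left j k)
  have h2 := S.antitone_right_index y (le_max_right j k)
  have h3 := S.ρ_nonneg (max j k)
  simp only at h1 h2
  linarith

theorem point_le (y : ℝ) (k : ℕ) : S.point y ≤ S.left k (S.index k y) + S.ρ k :=
  ciSup_le fun j => S.left_le_right y j k

theorem lt_point (y : ℝ) (k : ℕ) : S.left k (S.index k y) < S.point y :=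
  (S.strictMono_left_index y (Nat.lt_succ_self k)).trans_le
    (le_ciSup (f := fun k => S.left k (S.index k y))
      ⟨_, by rintro _ ⟨j, rfl⟩; exact S.left_le_right y j 0⟩ (k + 1))

theorem point_mem_Ioc (y : ℝ) : S.point y ∈ Ioc (0 : ℝ) 1 :=
  ⟨S.lt_point y 0, (S.point_le y 0).trans (S.left_bounds 0 _).2.1⟩

/-- Siblings whose numbers differ by Δ start in cells 3Δ apart, and each ends less than two cells
after its own cell begins. The distance is thus at least (3Δ - 2)/R, and 3Δ - 2 ≥ Δ. -/
theorem sub_le_point_sub {k : ℕ} {y z : ℝ} (h : S.index k y = S.index k z)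
    (hlt : S.index (k + 1) y < S.index (k + 1) z) :
    ((S.index (k + 1) z : ℝ) - S.index (k + 1) y) / S.R (k + 1) ≤ S.point z - S.point y := by
  have hy := S.point_le y (k + 1)
  have hz := S.lt_point z (k + 1)
  have h1 := S.left_lt_cell k (S.index (k + 1) y)
  have h2 := S.cell_le_left k (S.index (k + 1) z)
  have hρ := S.ρ_le (k + 1)
  have hdm1 := Nat.div_add_mod (S.index (k + 1) y) (S.m k)
  have hdm2 := Nat.div_add_mod (S.index (k + 1) z) (S.m k)
  rw [index_succ_div] at hdm1 hdm2
  have hcell : S.cell k (S.index (k + 1) z) + 3 * S.index (k + 1) y =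
      S.cell k (S.index (k + 1) y) + 3 * S.index (k + 1) z := by
    unfold cell
    rw [index_succ_div, index_succ_div, h]
    rw [h] at hdm1
    omega
  have hcell' : (S.cell k (S.index (k + 1) z) : ℝ) + 3 * S.index (k + 1) y =
      S.cell k (S.index (k + 1) y) + 3 * S.index (k + 1) z := by exact_mod_cast hcell
  have hlt' : (S.index (k + 1) y : ℝ) + 1 ≤ S.index (k + 1) z := by exact_mod_cast hlt
  have hR := S.R_pos' (k + 1)
  have : ((S.index (k + 1) z : ℝ) - S.index (k + 1) y) / S.R (k + 1) ≤
      (S.cell k (S.index (k + 1) z) : ℝ) / S.R (k + 1) -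
      ((S.cell k (S.index (k + 1) y) : ℝ) + 1) / S.R (k + 1) - 1 / S.R (k + 1) := by
    rw [← sub_div, ← sub_div]
    exact div_le_div_of_nonneg_right (by linarith) hR.le
  linarith

theorem exists_index_ne {y z : ℝ} (hy : 0 ≤ y) (hyz : y < z) :
    ∃ k, S.index k y ≠ S.index k z := by
  obtain ⟨k, hk⟩ := pow_unbounded_of_one_lt (1 / (z - y)) (one_lt_two : (1 : ℝ) < 2)
  refine ⟨k, fun h => ?_⟩
  have hc : (2 : ℝ) ^ k ≤ S.count k := by exact_mod_cast S.two_pow_le_count k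
  have h1 := Nat.floor_le (mul_nonneg (S.count_pos k).le hy)
  have h2 := Nat.lt_floor_add_one ((S.count k : ℝ) * z)
  change (S.index k y : ℝ) ≤ _ at h1
  change _ < (S.index k z : ℝ) + 1 at h2
  rw [h] at h1
  rw [div_lt_iff₀ (by linarith)] at hk
  nlinarith

/-- At the first level where `y` and `z` separate, the images are at least Δ/R apart, while z - y is
of order (Δ/m)(1/count). As Δ/m ≤ 1, it is at most its own power `s`, and `hS` bounds the other
factor. -/
theorem holder_of_lt {s : ℝ} (hs0 : 0 < s) (hs1 : s ≤ 1)
    (hS : ∀ k, 1 / (S.count k : ℝ) ≤ 6 * ((S.m k : ℝ) / S.R (k + 1)) ^ s)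
    {y z : ℝ} (hy : 0 ≤ y) (hz : z < 1) (hyz : y < z) :
    |z - y| ≤ 12 * |S.point z - S.point y| ^ s := by
  classical
  have hex := S.exists_index_ne hy hyz
  obtain ⟨k, hk⟩ : ∃ k, Nat.find hex = k + 1 := by
    refine Nat.exists_eq_succ_of_ne_zero fun h0 => ?_
    have := Nat.find_spec hex
    rw [h0] at this
    apply this
    simp [index, count, Nat.floor_eq_zero.2 hz, Nat.floor_eq_zero.2 (hyz.trans hz)]
  have hne : S.index (k + 1) y ≠ S.index (k + 1) z := hk ▸ Nat.find_spec hex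
  have heq : S.index k y = S.index k z := by
    have := Nat.find_min hex (m := k) (by omega)
    simpa using this
  have hle : S.index (k + 1) y ≤ S.index (k + 1) z :=
    Nat.floor_mono (mul_le_mul_of_nonneg_left hyz.le (S.count_pos _).le)
  have hlt := lt_of_le_of_ne hle hne
  have hp := S.sub_le_point_sub heq hlt
  have hR := S.R_pos' (k + 1)
  have hm0 : (0 : ℝ) < S.m k := by
    have := S.two_le_m k
    positivity
  have hdm1 := Nat.div_add_mod (S.index (k + 1) y) (S.m k)
  have hdm2 := Nat.div_add_mod (S.index (k + 1) z) (S.m k)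
  rw [index_succ_div] at hdm1 hdm2
  have hmod : S.index (k + 1) z % S.m k < S.m k :=
    Nat.mod_lt _ (by have := S.two_le_m k; omega)
  have hΔ : S.index (k + 1) z ≤ S.index (k + 1) y + S.m k := by
    rw [heq] at hdm1
    omega
  have hΔ' : (S.index (k + 1) z : ℝ) ≤ S.index (k + 1) y + S.m k := by exact_mod_cast hΔ
  have hlt' : (S.index (k + 1) y : ℝ) + 1 ≤ S.index (k + 1) z := by exact_mod_cast hlt
  set Δ : ℝ := (S.index (k + 1) z : ℝ) - S.index (k + 1) y with hΔdef
  have hΔ1 : 1 ≤ Δ := by linarith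
  have hΔm : Δ / S.m k ≤ 1 := by rw [div_le_one hm0]; linarith
  -- Rounding to indices gives count · (z - y) < Δ + 1 ≤ 2Δ.
  have hyzle : z - y ≤ 2 * (Δ / S.m k) * (1 / S.count k) := by
    have h1 := Nat.floor_le (mul_nonneg (S.count_pos (k + 1)).le hy)
    have h2 := Nat.lt_floor_add_one ((S.count (k + 1) : ℝ) * z)
    change (S.index (k + 1) y : ℝ) ≤ _ at h1
    change _ < (S.index (k + 1) z : ℝ) + 1 at h2
    have h3 : 2 * (Δ / S.m k) * (1 / S.count k) = 2 * Δ / S.count (k + 1) := by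
      rw [count_succ]; push_cast
      have := (S.count_pos k).ne'
      field_simp
    rw [h3, le_div_iff₀ (S.count_pos _)]
    linarith
  rw [abs_of_pos (by linarith), abs_of_nonneg ((by positivity : 0 ≤ Δ / S.R (k + 1)).trans hp)]
  calc z - y ≤ 2 * (Δ / S.m k) * (1 / S.count k) := hyzle
    _ ≤ 2 * (Δ / S.m k) ^ s * (6 * ((S.m k : ℝ) / S.R (k + 1)) ^ s) := by
        gcongr
        · exact Real.self_le_rpow_of_le_one (by positivity) hΔm hs1
        · exact hS k
    _ = 12 * (Δ / S.R (k + 1)) ^ s := by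
        have : Δ / S.R (k + 1) = Δ / S.m k * (S.m k / S.R (k + 1)) := by field_simp
        rw [this, Real.mul_rpow (by positivity) (by positivity)]
        ring
    _ ≤ 12 * (S.point z - S.point y) ^ s := by gcongr

theorem le_dimH {s : NNReal} (hs0 : 0 < s) (hs1 : s ≤ 1)
    (hS : ∀ k, 1 / (S.count k : ℝ) ≤ 6 * ((S.m k : ℝ) / S.R (k + 1)) ^ (s : ℝ))
    {E : Set ℝ} (hE : ∀ y, S.point y ∈ E) : (s : ENNReal) ≤ dimH E := by
  refine le_dimH_of_holder_leftInverse (C := 12) (g := S.point) hs0 (fun y _ => hE y) ?_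
  intro y hy z hz
  have hs0' : (0 : ℝ) < s := by exact_mod_cast hs0
  have hs1' : (s : ℝ) ≤ 1 := by exact_mod_cast hs1
  rcases lt_trichotomy y z with h | rfl | h
  · rw [abs_sub_comm, abs_sub_comm (S.point y)]
    exact_mod_cast S.holder_of_lt hs0' hs1' hS hy.1 hz.2 h
  · simp only [sub_self, abs_zero]; positivity
  · exact_mod_cast S.holder_of_lt hs0' hs1' hS hz.1 hy.2 h

end CantorScheme

/-! ### The Jarník-type theorem -/

theorem eventually_rpow_le_floor_mul {θ ρ : ℝ} (hθ : θ < 1) (hρ : 0 < ρ) :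
    ∀ᶠ R : ℕ in atTop, 2 ≤ ⌊ρ * R / 3⌋₊ ∧ (R : ℝ) ^ θ ≤ ⌊ρ * R / 3⌋₊ ∧
      ρ / 6 ≤ (⌊ρ * R / 3⌋₊ : ℝ) / R := by
  have h1 : Tendsto (fun R : ℕ => (R : ℝ) ^ (1 - θ)) atTop atTop :=
    (tendsto_rpow_atTop (by linarith)).comp tendsto_natCast_atTop_atTop
  have h2 : Tendsto (fun R : ℕ => (R : ℝ)) atTop atTop := tendsto_natCast_atTop_atTop
  filter_upwards [h1.eventually_ge_atTop (6 / ρ), h2.eventually_ge_atTop (6 / ρ),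
    eventually_gt_atTop 0] with R hR1 hR2 hR0
  have hR : (0 : ℝ) < R := by exact_mod_cast hR0
  rw [div_le_iff₀ hρ] at hR1 hR2
  have hfl := Nat.lt_floor_add_one (ρ * R / 3)
  have hge : ρ * R / 6 ≤ ⌊ρ * R / 3⌋₊ := by linarith
  refine ⟨Nat.le_floor (by push_cast; linarith), ?_, ?_⟩
  · refine le_trans ?_ hge
    rw [Real.rpow_sub hR, Real.rpow_one] at hR1
    have hp : 0 < (R : ℝ) ^ θ := Real.rpow_pos_of_pos hR _
    rw [div_mul_eq_mul_div, le_div_iff₀ hp] at hR1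
    linarith
  · rw [le_div_iff₀ hR]
    linarith

/-- A Jarník-type theorem: if `A R` is `1 / R`-dense from the left for every `R`, then the set of
points that are `R ^ (-(1 + τ))`-close to `A R` from the right for infinitely many `R` has dimension
at least `1 / (1 + τ)`. -/
theorem le_dimH_frequently_close {A : ℕ → Set ℝ}
    (hA : ∀ R : ℕ, 1 ≤ R → ∀ x : ℝ, 1 / (R : ℝ) < x → x ≤ 1 →
      ∃ c ∈ A R, c < x ∧ x - c ≤ 1 / R)
    {τ : ℝ} (hτ : 0 ≤ τ) {s : NNReal} (hs : 0 < s) (hsτ : s * (1 + τ) < 1) :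
    (s : ENNReal) ≤ dimH {x : ℝ | x ∈ Ioc (0 : ℝ) 1 ∧ ∃ᶠ R : ℕ in atTop,
      ∃ c ∈ A R, c < x ∧ x - c ≤ (R : ℝ) ^ (-(1 + τ))} := by
  have hs0 : (0 : ℝ) < s := by exact_mod_cast hs
  have hs1 : (s : ℝ) ≤ 1 := by nlinarith
  -- The interval length r^(-(1+τ)) is fixed before `R`, so `R` can be taken so large that one
  -- generation of children already outnumbers R^(s(1+τ)).
  have hnext : ∀ r : ℕ, ∃ R : ℕ, 1 ≤ r → r < R ∧ 2 ≤ ⌊(r : ℝ) ^ (-(1 + τ)) * R / 3⌋₊ ∧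
      (R : ℝ) ^ (s * (1 + τ)) ≤ ⌊(r : ℝ) ^ (-(1 + τ)) * R / 3⌋₊ ∧
      (r : ℝ) ^ (-(1 + τ)) / 6 ≤ (⌊(r : ℝ) ^ (-(1 + τ)) * R / 3⌋₊ : ℝ) / R := by
    intro r
    rcases Nat.eq_zero_or_pos r with h | h
    · exact ⟨0, fun h' => by omega⟩
    · have hr : (0 : ℝ) < (r : ℝ) ^ (-(1 + τ)) := by positivity
      obtain ⟨R, hR⟩ := ((eventually_gt_atTop r).and (eventually_rpow_le_floor_mul hsτ hr)).exists
      exact ⟨R, fun _ => hR⟩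
  choose next hnext using hnext
  have hc : ∀ R i : ℕ, ∃ c : ℝ, 1 ≤ i → i + 1 ≤ R →
      c ∈ A R ∧ (i : ℝ) / R ≤ c ∧ c < ((i : ℝ) + 1) / R := by
    intro R i
    by_cases h : 1 ≤ i ∧ i + 1 ≤ R
    · obtain ⟨h1, h2⟩ := h
      have h1' : (1 : ℝ) ≤ i := by exact_mod_cast h1
      have h2' : (i : ℝ) + 1 ≤ R := by exact_mod_cast h2
      have hR : (0 : ℝ) < R := by linarith
      -- Density is applied at the right end of the cell. It needs 1/R < (i + 1)/R ≤ 1, hence the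
      -- restrictions on `i`.
      obtain ⟨c, hcA, hlt, hle⟩ := hA R (by omega) (((i : ℝ) + 1) / R)
        (div_lt_div_of_pos_right (by linarith) hR) ((div_le_one hR).2 h2')
      refine ⟨c, fun _ _ => ⟨hcA, ?_, hlt⟩⟩
      rw [add_div] at hle
      linarith
    · exact ⟨0, fun h1 h2 => (h ⟨h1, h2⟩).elim⟩
  choose c hc using hc
  set R : ℕ → ℕ := fun k => next^[k] 1 with hRdef
  have hR0 : R 0 = 1 := rfl
  have hRs : ∀ k, R (k + 1) = next (R k) := fun k => Function.iterate_succ_apply' _ _ _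
  have hRpos : ∀ k, 1 ≤ R k := by
    intro k
    induction k with
    | zero => exact le_rfl
    | succ k ih => rw [hRs]; exact ih.trans (hnext _ ih).1.le
  have hRpos' : ∀ k, (1 : ℝ) ≤ R k := fun k => by exact_mod_cast hRpos k
  have hstep : ∀ k, _ := fun k => hnext (R k) (hRpos k)
  simp only [← hRs] at hstep
  let S : CantorScheme :=
    { R := R
      m := fun k => ⌊(R k : ℝ) ^ (-(1 + τ)) * R (k + 1) / 3⌋₊
      ρ := fun k => (R k : ℝ) ^ (-(1 + τ))
      c := fun k i => c (R k) i
      R_pos := hRpos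
      two_le_m := fun k => (hstep k).2.1
      ρ_nonneg := fun k => by positivity
      ρ_zero := by simp [hR0]
      ρ_le := fun k => by
        rw [one_div, ← Real.rpow_neg_one]
        exact Real.rpow_le_rpow_of_exponent_le (hRpos' k) (by linarith)
      m_le := fun k => by
        have := Nat.floor_le (a := (R k : ℝ) ^ (-(1 + τ)) * R (k + 1) / 3) (by positivity)
        linarith
      le_c := fun k i h1 h2 => (hc _ _ h1 h2).2.1
      c_lt := fun k i h1 h2 => (hc _ _ h1 h2).2.2 }
  have hcount : ∀ k, (R k : ℝ) ^ (s * (1 + τ)) ≤ S.count k := by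
    intro k
    cases k with
    | zero => simp [hR0, CantorScheme.count]
    | succ k =>
      refine (hstep k).2.2.1.trans ?_
      rw [S.count_succ]
      have h1 : 1 ≤ S.count k := Nat.one_le_two_pow.trans (S.two_pow_le_count k)
      exact_mod_cast Nat.le_mul_of_pos_left _ h1
  refine S.le_dimH hs (by exact_mod_cast hs1) (fun k => ?_) (fun y => ⟨S.point_mem_Ioc y, ?_⟩)
  · have hRk : (0 : ℝ) < R k := by linarith [hRpos' k]
    calc 1 / (S.count k : ℝ) ≤ 1 / (R k : ℝ) ^ (s * (1 + τ)) :=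
          one_div_le_one_div_of_le (by positivity) (hcount k)
      _ = ((R k : ℝ) ^ (-(1 + τ))) ^ (s : ℝ) := by
          rw [one_div, ← Real.rpow_neg hRk.le, ← Real.rpow_mul hRk.le]
          congr 1
          ring
      -- The 6 pays for the gaps (factor 3) and for the floor in `m` (factor 2).
      _ = (6 : ℝ) ^ (s : ℝ) * ((R k : ℝ) ^ (-(1 + τ)) / 6) ^ (s : ℝ) := by
          rw [← Real.mul_rpow (by norm_num) (by positivity)]
          congr 1
          ring
      _ ≤ 6 * ((S.m k : ℝ) / S.R (k + 1)) ^ (s : ℝ) := by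
          refine mul_le_mul (Real.rpow_le_self_of_one_le (by norm_num) hs1) ?_ (by positivity)
            (by norm_num)
          exact Real.rpow_le_rpow (by positivity) (hstep k).2.2.2 hs0.le
  · have hmono : StrictMono R := strictMono_nat_of_lt_succ fun k => (hstep k).1
    rw [frequently_atTop]
    intro N
    refine ⟨R (N + 1), (Nat.le_succ N).trans hmono.le_apply,
      S.left (N + 1) (S.index (N + 1) y), ?_, S.lt_point y _, ?_⟩
    · exact (hc _ _ (S.one_le_cell N _) (S.cell_add_one_le N _)).1
    · have := S.point_le y (N + 1)
      change _ ≤ S.ρ (N + 1)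
      linarith

/-! ### Lüroth expansions and their approximation properties -/

theorem lurothDigit_zero (x : ℝ) : lurothDigit x 0 = ⌊1 / x⌋₊ + 1 := rfl

theorem lurothDigit_succ (x : ℝ) (k : ℕ) :
    lurothDigit x (k + 1) = lurothDigit (lurothMap x) k := rfl

theorem one_le_floor_one_div {x : ℝ} (hx : x ∈ Ioc (0 : ℝ) 1) : 1 ≤ ⌊1 / x⌋₊ := by
  refine Nat.le_floor ?_
  rw [Nat.cast_one, le_div_iff₀ hx.1]
  linarith [hx.2]

theorem lurothMap_eq {x : ℝ} (hx : x ∈ Ioc (0 : ℝ) 1) :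
    lurothMap x = (⌊1 / x⌋₊ : ℝ) * (((⌊1 / x⌋₊ : ℝ) + 1) * x - 1) := by
  have h : (⌊1 / x⌋ : ℝ) = (⌊1 / x⌋₊ : ℝ) :=
    (natCast_floor_eq_intCast_floor (one_div_nonneg.2 hx.1.le)).symm
  unfold lurothMap
  rw [Int.floor_add_one]
  push_cast
  rw [h]

theorem lurothMap_mem {x : ℝ} (hx : x ∈ Ioc (0 : ℝ) 1) : lurothMap x ∈ Ioc (0 : ℝ) 1 := by
  rw [lurothMap_eq hx]
  have h1 : (1 : ℝ) ≤ ⌊1 / x⌋₊ := by exact_mod_cast one_le_floor_one_div hx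
  have h2 := Nat.floor_le (one_div_nonneg.2 hx.1.le)
  have h3 := Nat.lt_floor_add_one (1 / x)
  rw [le_div_iff₀ hx.1] at h2
  rw [div_lt_iff₀ hx.1] at h3
  constructor
  · apply mul_pos <;> linarith
  · nlinarith

theorem lurothMap_iterate_mem {x : ℝ} (hx : x ∈ Ioc (0 : ℝ) 1) (n : ℕ) :
    lurothMap^[n] x ∈ Ioc (0 : ℝ) 1 := by
  induction n with
  | zero => exact hx
  | succ n ih => rw [Function.iterate_succ_apply']; exact lurothMap_mem ih

theorem two_le_lurothDigit {x : ℝ} (hx : x ∈ Ioc (0 : ℝ) 1) (k : ℕ) : 2 ≤ lurothDigit x k := by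
  have := one_le_floor_one_div (lurothMap_iterate_mem hx k)
  unfold lurothDigit
  omega

theorem two_le_lurothDigit_real {x : ℝ} (hx : x ∈ Ioc (0 : ℝ) 1) (k : ℕ) :
    (2 : ℝ) ≤ lurothDigit x k := by exact_mod_cast two_le_lurothDigit hx k

/-- The product `∏_{j < n} d_j (d_j - 1)`: the reciprocal of the length of the cylinder of order
`n` that contains `x`. -/
noncomputable def lurothProd (x : ℝ) (n : ℕ) : ℝ :=
  ∏ j ∈ Finset.range n, (lurothDigit x j : ℝ) * ((lurothDigit x j : ℝ) - 1)

theorem lurothProd_succ (x : ℝ) (n : ℕ) : lurothProd x (n + 1) =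
    lurothProd x n * ((lurothDigit x n : ℝ) * ((lurothDigit x n : ℝ) - 1)) :=
  Finset.prod_range_succ _ _

theorem lurothProd_succ' (x : ℝ) (n : ℕ) : lurothProd x (n + 1) =
    (lurothDigit x 0 : ℝ) * ((lurothDigit x 0 : ℝ) - 1) * lurothProd (lurothMap x) n := by
  unfold lurothProd
  rw [Finset.prod_range_succ', mul_comm]
  rfl

theorem two_pow_le_lurothProd {x : ℝ} (hx : x ∈ Ioc (0 : ℝ) 1) (n : ℕ) :
    2 ^ n ≤ lurothProd x n := by
  induction n with
  | zero => simp [lurothProd]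
  | succ n ih =>
    rw [lurothProd_succ, pow_succ]
    have := two_le_lurothDigit_real hx n
    have h2 : (2 : ℝ) ≤ (lurothDigit x n : ℝ) * ((lurothDigit x n : ℝ) - 1) := by nlinarith
    exact mul_le_mul ih h2 (by norm_num) ((by positivity : (0 : ℝ) ≤ 2 ^ n).trans ih)

theorem lurothProd_pos {x : ℝ} (hx : x ∈ Ioc (0 : ℝ) 1) (n : ℕ) : 0 < lurothProd x n :=
  (by positivity : (0 : ℝ) < 2 ^ n).trans_le (two_pow_le_lurothProd hx n)

theorem lurothDen_cast {x : ℝ} (hx : x ∈ Ioc (0 : ℝ) 1) (n : ℕ) :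
    (lurothDen x n : ℝ) = lurothDigit x n * lurothProd x n := by
  unfold lurothDen lurothProd
  push_cast
  congr 1
  refine Finset.prod_congr rfl fun j _ => ?_
  rw [Nat.cast_sub ((by norm_num : 1 ≤ 2).trans (two_le_lurothDigit hx j)), Nat.cast_one]

theorem lt_lurothDen {x : ℝ} (hx : x ∈ Ioc (0 : ℝ) 1) (n : ℕ) : n < lurothDen x n := by
  have h : (2 : ℝ) ^ n ≤ lurothDen x n := by
    rw [lurothDen_cast hx]
    have h1 := two_le_lurothDigit_real hx n
    have h2 := two_pow_le_lurothProd hx n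
    have h3 := lurothProd_pos hx n
    nlinarith
  exact Nat.lt_two_pow_self.trans_le (by exact_mod_cast h)

theorem lurothDen_succ {x : ℝ} (hx : x ∈ Ioc (0 : ℝ) 1) (n : ℕ) : (lurothDen x (n + 1) : ℝ) =
    (lurothDigit x 0 : ℝ) * ((lurothDigit x 0 : ℝ) - 1) * lurothDen (lurothMap x) n := by
  rw [lurothDen_cast hx, lurothDen_cast (lurothMap_mem hx), lurothProd_succ', lurothDigit_succ]
  ring

/-- On the cylinder (1/d, 1/(d - 1)] the map T is the increasing affine bijection onto (0, 1].
Iteration gives the exact error in `sub_lurothConvergent`. -/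
theorem sub_one_div_lurothDigit {x : ℝ} (hx : x ∈ Ioc (0 : ℝ) 1) : x - 1 / lurothDigit x 0 =
    lurothMap x / ((lurothDigit x 0 : ℝ) * ((lurothDigit x 0 : ℝ) - 1)) := by
  have h1 : (1 : ℝ) ≤ ⌊1 / x⌋₊ := by exact_mod_cast one_le_floor_one_div hx
  rw [lurothMap_eq hx, lurothDigit_zero]
  push_cast
  have : (⌊1 / x⌋₊ : ℝ) + 1 - 1 = ⌊1 / x⌋₊ := by ring
  rw [this]
  have h2 : (⌊1 / x⌋₊ : ℝ) ≠ 0 := by positivity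
  have h3 : (⌊1 / x⌋₊ : ℝ) + 1 ≠ 0 := by positivity
  field_simp

theorem le_one_div_lurothDigit_sub_one {x : ℝ} (hx : x ∈ Ioc (0 : ℝ) 1) :
    x ≤ 1 / ((lurothDigit x 0 : ℝ) - 1) := by
  have h1 : (1 : ℝ) ≤ ⌊1 / x⌋₊ := by exact_mod_cast one_le_floor_one_div hx
  have h2 := Nat.floor_le (one_div_nonneg.2 hx.1.le)
  rw [lurothDigit_zero]
  push_cast
  rw [add_sub_cancel_right, le_div_iff₀ (by linarith)]
  rw [le_div_iff₀ hx.1] at h2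
  linarith

theorem lurothConvergent_zero (x : ℝ) : lurothConvergent x 0 = 1 / lurothDigit x 0 := by
  simp [lurothConvergent]

theorem lurothConvergent_succ (x : ℝ) (n : ℕ) : lurothConvergent x (n + 1) =
    1 / lurothDigit x 0 + lurothConvergent (lurothMap x) n /
      ((lurothDigit x 0 : ℝ) * ((lurothDigit x 0 : ℝ) - 1)) := by
  unfold lurothConvergent
  rw [Finset.sum_range_succ', add_comm, Finset.sum_div]
  congr 1
  · simp
  · refine Finset.sum_congr rfl fun k _ => ?_
    have := lurothProd_succ' x k
    unfold lurothProd at this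
    rw [this, div_div, lurothDigit_succ]
    congr 1
    ring

theorem sub_lurothConvergent {x : ℝ} (hx : x ∈ Ioc (0 : ℝ) 1) (n : ℕ) :
    x - lurothConvergent x n = lurothMap^[n + 1] x / lurothProd x (n + 1) := by
  induction n generalizing x with
  | zero =>
    rw [lurothConvergent_zero, sub_one_div_lurothDigit hx]
    simp [lurothProd]
  | succ n ih =>
    rw [lurothConvergent_succ, ← sub_sub, sub_one_div_lurothDigit hx, ← sub_div,
      ih (lurothMap_mem hx), lurothProd_succ' x (n + 1), div_div, mul_comm (lurothProd _ _)]
    rfl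

theorem lurothConvergent_lt {x : ℝ} (hx : x ∈ Ioc (0 : ℝ) 1) (n : ℕ) :
    lurothConvergent x n < x := by
  have h := sub_lurothConvergent hx n
  have := div_pos (lurothMap_iterate_mem hx (n + 1)).1 (lurothProd_pos hx (n + 1))
  linarith

theorem monotone_lurothConvergent {x : ℝ} (hx : x ∈ Ioc (0 : ℝ) 1) :
    Monotone (lurothConvergent x) := by
  refine monotone_nat_of_le_succ fun n => ?_
  unfold lurothConvergent
  rw [Finset.sum_range_succ _ (n + 1)]
  have h1 := lurothProd_pos hx (n + 1)
  unfold lurothProd at h1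
  have : 0 ≤ 1 / ((lurothDigit x (n + 1) : ℝ) * ∏ j ∈ Finset.range (n + 1),
    (lurothDigit x j : ℝ) * ((lurothDigit x j : ℝ) - 1)) := by positivity
  linarith

/-- A Dirichlet-type theorem for Lüroth convergents. -/
theorem exists_lurothDen_le {R : ℕ} (hR : 1 ≤ R) {x : ℝ} (hx : x ∈ Ioc (0 : ℝ) 1)
    (hRx : 1 / (R : ℝ) < x) :
    ∃ n, lurothDen x n ≤ 2 * R ∧ x - lurothConvergent x n ≤ 1 / R := by
  classical
  have hex : ∃ n, 2 * R < lurothDen x n := ⟨2 * R, lt_lurothDen hx _⟩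
  have hR0 : (1 : ℝ) ≤ R := by exact_mod_cast hR
  have h0 : lurothDen x 0 ≤ 2 * R := by
    have h1 : 1 / x < R := by
      rw [div_lt_iff₀ (by linarith)] at hRx
      rw [div_lt_iff₀ hx.1]
      linarith
    have h2 : ⌊1 / x⌋₊ < R := (Nat.floor_lt (one_div_nonneg.2 hx.1.le)).2 h1
    simp only [lurothDen, lurothDigit_zero, Finset.range_zero, Finset.prod_empty, mul_one]
    omega
  obtain ⟨n, hn⟩ : ∃ n, Nat.find hex = n + 1 := by
    refine Nat.exists_eq_succ_of_ne_zero fun h => ?_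
    have := Nat.find_spec hex
    rw [h] at this
    omega
  have h1 : 2 * R < lurothDen x (n + 1) := hn ▸ Nat.find_spec hex
  have h2 : lurothDen x n ≤ 2 * R := not_lt.1 (Nat.find_min hex (by omega))
  refine ⟨n, h2, ?_⟩
  rw [sub_lurothConvergent hx]
  have hT := le_one_div_lurothDigit_sub_one (lurothMap_iterate_mem hx (n + 1))
  change _ ≤ 1 / ((lurothDigit x (n + 1) : ℝ) - 1) at hT
  have hd := two_le_lurothDigit_real hx (n + 1)
  have hp := lurothProd_pos hx (n + 1)
  have h3 : (2 * R : ℝ) < lurothDigit x (n + 1) * lurothProd x (n + 1) := by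
    rw [← lurothDen_cast hx]; exact_mod_cast h1
  calc lurothMap^[n + 1] x / lurothProd x (n + 1)
      ≤ 1 / ((lurothDigit x (n + 1) : ℝ) - 1) / lurothProd x (n + 1) := by gcongr
    _ = 1 / (((lurothDigit x (n + 1) : ℝ) - 1) * lurothProd x (n + 1)) := by rw [div_div]
    -- From d ≥ 2 follows d - 1 ≥ d/2; this is the origin of the 2 in 2R.
    _ ≤ 1 / R := by
      refine one_div_le_one_div_of_le (by linarith) ?_
      nlinarith

/-- Lüroth convergents are best approximations from below. -/
theorem exists_lurothConvergent_ge {x y : ℝ} (hx : x ∈ Ioc (0 : ℝ) 1) (hy : y ∈ Ioc (0 : ℝ) 1)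
    (n : ℕ) (hxy : lurothConvergent x n < y) :
    ∃ m, lurothDen y m ≤ lurothDen x n ∧ lurothConvergent x n ≤ lurothConvergent y m := by
  induction n generalizing x y with
  | zero =>
    rw [lurothConvergent_zero] at hxy
    have hd := two_le_lurothDigit_real hx 0
    have h1 : lurothDigit y 0 ≤ lurothDigit x 0 := by
      rw [lurothDigit_zero y]
      refine (Nat.floor_lt (one_div_nonneg.2 hy.1.le)).2 ?_
      rw [div_lt_iff₀ (by linarith)] at hxy
      rw [div_lt_iff₀ hy.1]
      linarith
    refine ⟨0, by simpa [lurothDen] using h1, ?_⟩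
    rw [lurothConvergent_zero, lurothConvergent_zero]
    have := two_le_lurothDigit_real hy 0
    exact one_div_le_one_div_of_le (by linarith) (by exact_mod_cast h1)
  | succ n ih =>
    have hdx := two_le_lurothDigit_real hx 0
    have hdy := two_le_lurothDigit_real hy 0
    have hlt : 1 / (lurothDigit x 0 : ℝ) < y := by
      have := monotone_lurothConvergent hx (Nat.zero_le (n + 1))
      rw [lurothConvergent_zero] at this
      linarith
    have h1 : lurothDigit y 0 ≤ lurothDigit x 0 := by
      rw [lurothDigit_zero y]
      refine (Nat.floor_lt (one_div_nonneg.2 hy.1.le)).2 ?_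
      rw [div_lt_iff₀ (by linarith)] at hlt
      rw [div_lt_iff₀ hy.1]
      linarith
    have hdd : 0 < (lurothDigit x 0 : ℝ) * ((lurothDigit x 0 : ℝ) - 1) :=
      mul_pos (by linarith) (by linarith)
    -- If the first digit of `y` is smaller, its cylinder lies to the right of that of `x`, and its
    -- first convergent already suffices. If the digits agree, T acts on both by the same increasing
    -- affine map and scales the denominators alike.
    rcases h1.lt_or_eq with h | h
    · have h' : (lurothDigit y 0 : ℝ) ≤ lurothDigit x 0 - 1 := by
        have : (lurothDigit y 0 : ℝ) + 1 ≤ lurothDigit x 0 := by exact_mod_cast h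
        linarith
      refine ⟨0, ?_, ?_⟩
      · have h2 : (lurothDen y 0 : ℝ) ≤ lurothDen x (n + 1) := by
          rw [lurothDen_succ hx]
          have h3 : (lurothDen y 0 : ℝ) = lurothDigit y 0 := by simp [lurothDen]
          have h4 : (1 : ℝ) ≤ lurothDen (lurothMap x) n := by
            exact_mod_cast Nat.one_le_of_lt (lt_lurothDen (lurothMap_mem hx) n)
          rw [h3]
          nlinarith
        exact_mod_cast h2
      · rw [lurothConvergent_zero]
        have h2 := lurothConvergent_lt hx (n + 1)
        have h3 := le_one_div_lurothDigit_sub_one hx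
        have h4 := one_div_le_one_div_of_le (by linarith : (0 : ℝ) < lurothDigit y 0) h'
        linarith
    · have hT : lurothConvergent (lurothMap x) n < lurothMap y := by
        have h2 := sub_one_div_lurothDigit hy
        rw [lurothConvergent_succ] at hxy
        rw [h] at h2
        have h3 : lurothConvergent (lurothMap x) n /
            ((lurothDigit x 0 : ℝ) * ((lurothDigit x 0 : ℝ) - 1)) <
            lurothMap y / ((lurothDigit x 0 : ℝ) * ((lurothDigit x 0 : ℝ) - 1)) := by
          linarith
        exact (div_lt_div_iff_of_pos_right hdd).1 h3
      obtain ⟨m, hm1, hm2⟩ := ih (lurothMap_mem hx) (lurothMap_mem hy) hT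
      refine ⟨m + 1, ?_, ?_⟩
      · have hm1' : (lurothDen (lurothMap y) m : ℝ) ≤ lurothDen (lurothMap x) n := by
          exact_mod_cast hm1
        have h2 : (lurothDen y (m + 1) : ℝ) ≤ lurothDen x (n + 1) := by
          rw [lurothDen_succ hx, lurothDen_succ hy, h]
          exact mul_le_mul_of_nonneg_left hm1' hdd.le
        exact_mod_cast h2
      · rw [lurothConvergent_succ, lurothConvergent_succ, h]
        have := div_le_div_of_nonneg_right hm2 hdd.le
        linarith

/-! ### The lower bound for L(ψ) -/

theorem mem_lurothWellApproximable {ψ : ℕ → ℝ} {x : ℝ} : x ∈ lurothWellApproximable ψ ↔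
    x ∈ Ioc (0 : ℝ) 1 ∧
      ∃ᶠ n in atTop, x - lurothConvergent x n < ψ (lurothDen x n) / lurothDen x n := by
  unfold lurothWellApproximable
  rw [mem_limsup_iff_frequently_mem]
  simp only [mem_ofPred_eq, frequently_and_distrib_left]
  refine and_congr_right fun hx => ?_
  have h : ∀ n, |x - lurothNum x n / lurothDen x n| = x - lurothConvergent x n := by
    intro n
    have h0 : (lurothDen x n : ℝ) ≠ 0 := by
      exact_mod_cast ((Nat.zero_le n).trans_lt (lt_lurothDen hx n)).ne'
    rw [lurothNum, mul_div_cancel_right₀ _ h0, abs_of_pos (sub_pos.2 (lurothConvergent_lt hx n))]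
  simp only [h]

theorem le_dimH_lurothWellApproximable {ψ : ℕ → ℝ} {τ : ℝ} (hτ : 0 ≤ τ)
    (hψ : ∀ᶠ q : ℕ in atTop, (q : ℝ) ^ (-τ) < ψ q) {s : NNReal} (hs : 0 < s)
    (hsτ : s * (1 + τ) < 1) : (s : ENNReal) ≤ dimH (lurothWellApproximable ψ) := by
  have hs0 : (0 : ℝ) < s := by exact_mod_cast hs
  -- The slack between `τ` and `τ'` absorbs the factor 2 in Q ≤ 2R.
  obtain ⟨τ', hτ', hsτ'⟩ : ∃ τ', τ < τ' ∧ s * (1 + τ') < 1 := by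
    have : τ < 1 / s - 1 := by
      rw [lt_sub_iff_add_lt, lt_div_iff₀ hs0]
      linarith
    obtain ⟨τ', h1, h2⟩ := exists_between this
    refine ⟨τ', h1, ?_⟩
    rw [lt_sub_iff_add_lt, lt_div_iff₀ hs0] at h2
    linarith
  refine (le_dimH_frequently_close
    (A := fun R => {c | ∃ x ∈ Ioc (0 : ℝ) 1, ∃ n, lurothDen x n ≤ 2 * R ∧ lurothConvergent x n = c})
    ?_ (hτ.trans hτ'.le) hs hsτ').trans (dimH_mono ?_)
  · intro R hR x hRx hx1
    have hx : x ∈ Ioc (0 : ℝ) 1 := ⟨lt_of_le_of_lt (by positivity) hRx, hx1⟩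
    obtain ⟨n, h1, h2⟩ := exists_lurothDen_le hR hx hRx
    exact ⟨_, ⟨x, hx, n, h1, rfl⟩, lurothConvergent_lt hx n, h2⟩
  · rintro x ⟨hx, hfreq⟩
    refine mem_lurothWellApproximable.2 ⟨hx, ?_⟩
    obtain ⟨q₀, hq₀⟩ := eventually_atTop.1 hψ
    rw [frequently_atTop]
    intro n₀
    have hδ : 0 < x - lurothConvergent x (max n₀ q₀) := sub_pos.2 (lurothConvergent_lt hx _)
    have hsmall : ∀ᶠ R : ℕ in atTop, (R : ℝ) ^ (-(1 + τ')) < x - lurothConvergent x (max n₀ q₀) :=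
      ((tendsto_rpow_neg_atTop (by linarith)).comp
        tendsto_natCast_atTop_atTop).eventually_lt_const hδ
    have hexp : ∀ᶠ R : ℕ in atTop, (2 : ℝ) ^ (1 + τ) ≤ (R : ℝ) ^ (τ' - τ) :=
      ((tendsto_rpow_atTop (by linarith)).comp
        tendsto_natCast_atTop_atTop).eventually_ge_atTop _
    obtain ⟨R, ⟨c, ⟨z, hz, k, hk, rfl⟩, hlt, hle⟩, hR1, hR2, hR0⟩ :=
      (hfreq.and_eventually (hsmall.and (hexp.and (eventually_gt_atTop 0)))).exists
    obtain ⟨n, hn1, hn2⟩ := exists_lurothConvergent_ge hz hx k hlt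
    -- Convergents of `x` up to this index stay a fixed distance below `x`, too far once `R` is
    -- large.
    have hn : max n₀ q₀ < n := by
      by_contra! hcon
      have := monotone_lurothConvergent hx hcon
      linarith
    refine ⟨n, (le_max_left _ _).trans hn.le, ?_⟩
    have hden := lt_lurothDen hx n
    have hψn := hq₀ (lurothDen x n) (((le_max_right _ _).trans hn.le).trans hden.le)
    have hQ : (0 : ℝ) < lurothDen x n := by exact_mod_cast (Nat.zero_le n).trans_lt hden
    have hRr : (0 : ℝ) < R := by exact_mod_cast hR0
    have hQR : (lurothDen x n : ℝ) ≤ 2 * R := by exact_mod_cast hn1.trans hk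
    calc x - lurothConvergent x n ≤ (R : ℝ) ^ (-(1 + τ')) := by linarith
      _ ≤ (2 * R : ℝ) ^ (-(1 + τ)) := by
          rw [Real.mul_rpow (by norm_num) hRr.le, Real.rpow_neg (by norm_num : (0 : ℝ) ≤ 2),
            ← div_eq_inv_mul, le_div_iff₀ (by positivity)]
          calc (R : ℝ) ^ (-(1 + τ')) * 2 ^ (1 + τ)
              ≤ (R : ℝ) ^ (-(1 + τ')) * (R : ℝ) ^ (τ' - τ) := by gcongr
            _ = (R : ℝ) ^ (-(1 + τ)) := by
                rw [← Real.rpow_add hRr]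
                congr 1
                ring
      _ ≤ (lurothDen x n : ℝ) ^ (-(1 + τ)) :=
          Real.rpow_le_rpow_of_nonpos hQ hQR (by linarith)
      _ = (lurothDen x n : ℝ) ^ (-τ) / lurothDen x n := by
          rw [← Real.rpow_sub_one hQ.ne']
          congr 1
          ring
      _ < ψ (lurothDen x n) / lurothDen x n := by gcongr

/-! ### The upper bound for L(ψ) -/

theorem ENNReal.tsum_fin_prod (a : ℕ → ENNReal) (n : ℕ) :
    ∑' w : Fin n → ℕ, ∏ j, a (w j) = (∑' e, a e) ^ n := by
  induction n with
  | zero => simp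
  | succ n ih =>
    rw [← (Fin.consEquiv fun _ => ℕ).tsum_eq, ENNReal.tsum_prod', pow_succ', ← ENNReal.tsum_mul_right]
    refine tsum_congr fun e => ?_
    rw [← ih, ← ENNReal.tsum_mul_left]
    refine tsum_congr fun w => ?_
    rw [Fin.prod_univ_succ]
    simp [Fin.consEquiv]

/-- The terms are the lengths of the first-order cylinders, which tile (0, 1]; the sum telescopes.
-/
theorem tsum_ofReal_one_div_mul_succ_le :
    ∑' e : ℕ, ENNReal.ofReal (1 / (((e : ℝ) + 2) * ((e : ℝ) + 1))) ≤ 1 := by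
  refine ENNReal.tsum_le_of_sum_range_le fun n => ?_
  rw [← ENNReal.ofReal_sum_of_nonneg fun _ _ => by positivity, ENNReal.ofReal_le_one]
  have : ∑ e ∈ Finset.range n, 1 / (((e : ℝ) + 2) * ((e : ℝ) + 1)) = 1 - 1 / ((n : ℝ) + 1) := by
    induction n with
    | zero => simp
    | succ n ih =>
      rw [Finset.sum_range_succ, ih]
      push_cast
      field_simp
      ring
  rw [this]
  have : (0 : ℝ) ≤ 1 / ((n : ℝ) + 1) := by positivity
  linarith

/-- Every base is at least 2, so raising the exponent from 1 to `t` gains a uniform factor 2^(1-t) <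
1. -/
theorem tsum_ofReal_rpow_lt_one {t : ℝ} (ht : 1 < t) :
    ∑' e : ℕ, ENNReal.ofReal ((((e : ℝ) + 2) * ((e : ℝ) + 1)) ^ (-t)) < 1 := by
  calc ∑' e : ℕ, ENNReal.ofReal ((((e : ℝ) + 2) * ((e : ℝ) + 1)) ^ (-t))
      ≤ ∑' e : ℕ, ENNReal.ofReal ((2 : ℝ) ^ (1 - t)) *
          ENNReal.ofReal (1 / (((e : ℝ) + 2) * ((e : ℝ) + 1))) := by
        refine ENNReal.tsum_le_tsum fun e => ?_
        rw [← ENNReal.ofReal_mul (by positivity)]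
        refine ENNReal.ofReal_le_ofReal ?_
        have hpos : (0 : ℝ) < ((e : ℝ) + 2) * ((e : ℝ) + 1) := by positivity
        have h2 : (2 : ℝ) ≤ ((e : ℝ) + 2) * ((e : ℝ) + 1) := by
          have : (0 : ℝ) ≤ e := e.cast_nonneg
          nlinarith
        have : -t = (1 - t) - 1 := by ring
        rw [this, Real.rpow_sub_one hpos.ne', div_eq_mul_one_div]
        exact mul_le_mul_of_nonneg_right
          (Real.rpow_le_rpow_of_nonpos (by norm_num) h2 (by linarith)) (by positivity)
    _ ≤ ENNReal.ofReal ((2 : ℝ) ^ (1 - t)) * 1 := by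
        rw [ENNReal.tsum_mul_left]
        gcongr
        exact tsum_ofReal_one_div_mul_succ_le
    _ < 1 := by
        rw [mul_one, ENNReal.ofReal_lt_one]
        exact Real.rpow_lt_one_of_one_lt_of_neg (by norm_num) (by linarith)

/-- The denominator `Q_{n+1}` of a Lüroth expansion with first digits `w j + 2`, `j < n`, and
`d + 2`. -/
noncomputable def wordDen (i : Σ n : ℕ, (Fin n → ℕ) × ℕ) : ℝ :=
  ((i.2.2 : ℝ) + 2) * ∏ j, ((i.2.1 j : ℝ) + 2) * ((i.2.1 j : ℝ) + 1)

theorem wordDen_pos (i : Σ n : ℕ, (Fin n → ℕ) × ℕ) : 0 < wordDen i :=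
  mul_pos (by positivity) (Finset.prod_pos fun _ _ => by positivity)

theorem tsum_wordDen_rpow_ne_top {t : ℝ} (ht : 1 < t) :
    ∑' i, ENNReal.ofReal (wordDen i ^ (-t)) ≠ ⊤ := by
  have h : ∀ i, ENNReal.ofReal (wordDen i ^ (-t)) =
      (∏ j, ENNReal.ofReal ((((i.2.1 j : ℝ) + 2) * ((i.2.1 j : ℝ) + 1)) ^ (-t))) *
        ENNReal.ofReal (((i.2.2 : ℝ) + 2) ^ (-t)) := by
    intro i
    unfold wordDen
    rw [Real.mul_rpow (by positivity) (Finset.prod_nonneg fun _ _ => by positivity),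
      ← Real.finsetProd_rpow _ _ fun _ _ => by positivity,
      ENNReal.ofReal_mul (by positivity), mul_comm,
      ENNReal.ofReal_prod_of_nonneg fun _ _ => by positivity]
  simp only [h]
  rw [ENNReal.tsum_sigma']
  have h2 : ∀ n : ℕ, ∑' p : (Fin n → ℕ) × ℕ,
      (∏ j, ENNReal.ofReal ((((p.1 j : ℝ) + 2) * ((p.1 j : ℝ) + 1)) ^ (-t))) *
        ENNReal.ofReal (((p.2 : ℝ) + 2) ^ (-t)) =
      (∑' e : ℕ, ENNReal.ofReal ((((e : ℝ) + 2) * ((e : ℝ) + 1)) ^ (-t))) ^ n *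
        ∑' d : ℕ, ENNReal.ofReal (((d : ℝ) + 2) ^ (-t)) := by
    intro n
    rw [ENNReal.tsum_prod', ← ENNReal.tsum_fin_prod
      (fun e : ℕ => ENNReal.ofReal ((((e : ℝ) + 2) * ((e : ℝ) + 1)) ^ (-t))),
      ← ENNReal.tsum_mul_right]
    refine tsum_congr fun w => ?_
    dsimp only
    exact ENNReal.tsum_mul_left
  simp only [h2]
  rw [ENNReal.tsum_mul_right, ENNReal.tsum_geometric]
  refine ENNReal.mul_ne_top ?_ ?_
  · exact ENNReal.inv_ne_top.2 (tsub_pos_of_lt (tsum_ofReal_rpow_lt_one ht)).ne'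
  · have hs : Summable fun d : ℕ => ((d : ℝ) + 2) ^ (-t) := by
      have := (summable_nat_add_iff 2).2 (Real.summable_nat_rpow.2 (by linarith : -t < -1))
      simpa using this
    exact hs.tsum_ofReal_ne_top

/-- The points with given first Lüroth digits that are close to the corresponding convergent. -/
def wordSet (ψ : ℕ → ℝ) (i : Σ n : ℕ, (Fin n → ℕ) × ℕ) : Set ℝ :=
  {x | x ∈ Ioc (0 : ℝ) 1 ∧ (∀ j : Fin i.1, lurothDigit x j = i.2.1 j + 2) ∧
    lurothDigit x i.1 = i.2.2 + 2 ∧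
    x - lurothConvergent x i.1 < ψ (lurothDen x i.1) / lurothDen x i.1}

theorem lurothDen_eq_wordDen {ψ : ℕ → ℝ} {i : Σ n : ℕ, (Fin n → ℕ) × ℕ} {x : ℝ}
    (hx : x ∈ wordSet ψ i) : (lurothDen x i.1 : ℝ) = wordDen i := by
  obtain ⟨h0, h1, h2, -⟩ := hx
  rw [lurothDen_cast h0, h2, lurothProd, ← Fin.prod_univ_eq_prod_range
    (fun j => (lurothDigit x j : ℝ) * ((lurothDigit x j : ℝ) - 1)), wordDen]
  congr 1
  · push_cast; rfl
  · refine Finset.prod_congr rfl fun j _ => ?_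
    rw [h1 j]
    push_cast
    ring

/-- All points of the set share one convergent and lie on the same side of it, so the diameter is at
most the one-sided error. -/
theorem ediam_wordSet_le {ψ : ℕ → ℝ} {τ : ℝ} {q₀ : ℕ}
    (hψ : ∀ q : ℕ, q₀ ≤ q → ψ q ≤ (q : ℝ) ^ (-τ)) (i : Σ n : ℕ, (Fin n → ℕ) × ℕ)
    (hi : q₀ ≤ i.1) : Metric.ediam (wordSet ψ i) ≤ ENNReal.ofReal (wordDen i ^ (-(1 + τ))) := by
  refine Metric.ediam_le fun x hx y hy => ?_
  have hclose : ∀ z ∈ wordSet ψ i, lurothConvergent z i.1 < z ∧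
      z - lurothConvergent z i.1 ≤ wordDen i ^ (-(1 + τ)) := by
    intro z hz
    refine ⟨lurothConvergent_lt hz.1 _, hz.2.2.2.le.trans ?_⟩
    have hle := hψ (lurothDen z i.1) (hi.trans (lt_lurothDen hz.1 _).le)
    rw [lurothDen_eq_wordDen hz] at hle ⊢
    have hpos := wordDen_pos i
    calc ψ (lurothDen z i.1) / wordDen i ≤ wordDen i ^ (-τ) / wordDen i := by gcongr
      _ = wordDen i ^ (-(1 + τ)) := by
        rw [← Real.rpow_sub_one hpos.ne']
        congr 1
        ring
  have hdig : ∀ j, j ≤ i.1 → lurothDigit x j = lurothDigit y j := by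
    intro j hj
    rcases hj.lt_or_eq with h | h
    · exact (hx.2.1 ⟨j, h⟩).trans (hy.2.1 ⟨j, h⟩).symm
    · rw [h]; exact hx.2.2.1.trans hy.2.2.1.symm
  have hconv : lurothConvergent x i.1 = lurothConvergent y i.1 := by
    unfold lurothConvergent
    refine Finset.sum_congr rfl fun k hk => ?_
    have hk' : k ≤ i.1 := Nat.lt_succ_iff.1 (Finset.mem_range.1 hk)
    rw [hdig k hk', Finset.prod_congr rfl fun j hj => by
      rw [hdig j ((Finset.mem_range.1 hj).le.trans hk')]]
  obtain ⟨hx1, hx2⟩ := hclose x hx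
  obtain ⟨hy1, hy2⟩ := hclose y hy
  rw [edist_dist, Real.dist_eq]
  refine ENNReal.ofReal_le_ofReal (abs_le.2 ⟨?_, ?_⟩) <;> rw [hconv] at * <;> linarith

theorem dimH_lurothWellApproximable_le {ψ : ℕ → ℝ} {τ : ℝ}
    (hψ : ∀ᶠ q : ℕ in atTop, ψ q ≤ (q : ℝ) ^ (-τ)) {s : NNReal} (hs : 0 < s)
    (hsτ : 1 < s * (1 + τ)) : dimH (lurothWellApproximable ψ) ≤ s := by
  have hs0 : (0 : ℝ) < s := by exact_mod_cast hs
  have hτ : 0 < 1 + τ := by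
    by_contra! h
    nlinarith
  obtain ⟨q₀, hq₀⟩ := eventually_atTop.1 hψ
  refine dimH_le_of_hausdorffMeasure_ne_top (ne_top_of_le_ne_top (tsum_wordDen_rpow_ne_top hsτ) ?_)
  refine (Measure.hausdorffMeasure_le_liminf_tsum (l := atTop) (s : ℝ) _
    (fun N : ℕ => ENNReal.ofReal ((N : ℝ) ^ (-(1 + τ)))) ?_
    -- Covers of every fineness share one index type; short words contribute empty sets. The full
    -- series is a bound for all of them, and its finiteness is enough.
    (fun N i => if N ≤ i.1 then wordSet ψ i else ∅) ?_ ?_).trans ?_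
  · have := ENNReal.tendsto_ofReal
      ((tendsto_rpow_neg_atTop hτ).comp tendsto_natCast_atTop_atTop)
    rwa [ENNReal.ofReal_zero] at this
  · filter_upwards [eventually_ge_atTop q₀, eventually_gt_atTop 0] with N hN hN0 i
    split_ifs with h
    · rcases (wordSet ψ i).eq_empty_or_nonempty with he | ⟨x, hx⟩
      · simp [he]
      · refine (ediam_wordSet_le hq₀ i (hN.trans h)).trans (ENNReal.ofReal_le_ofReal ?_)
        refine Real.rpow_le_rpow_of_nonpos (by exact_mod_cast hN0) ?_ (by linarith)
        rw [← lurothDen_eq_wordDen hx]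
        exact_mod_cast h.trans (lt_lurothDen hx.1 _).le
    · simp
  · refine Eventually.of_forall fun N x hx => ?_
    obtain ⟨hx, hfreq⟩ := mem_lurothWellApproximable.1 hx
    obtain ⟨n, hn, hlt⟩ := frequently_atTop.1 hfreq N
    refine mem_iUnion.2
      ⟨⟨n, fun j => lurothDigit x j - 2, lurothDigit x n - 2⟩, ?_⟩
    simp only [hn, if_true]
    refine ⟨hx, fun j => ?_, ?_, hlt⟩
    · exact (Nat.sub_add_cancel (two_le_lurothDigit hx j)).symm
    · exact (Nat.sub_add_cancel (two_le_lurothDigit hx n)).symm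
  · refine (liminf_le_of_frequently_le' (Eventually.frequently ?_))
    filter_upwards [eventually_ge_atTop q₀] with N hN
    refine ENNReal.tsum_le_tsum fun i => ?_
    have hexp : -((s : ℝ) * (1 + τ)) = -(1 + τ) * s := by ring
    rw [hexp, Real.rpow_mul (wordDen_pos i).le,
      ← ENNReal.ofReal_rpow_of_nonneg (Real.rpow_nonneg (wordDen_pos i).le _) hs0.le]
    refine ENNReal.rpow_le_rpow ?_ hs0.le
    split_ifs with h
    · exact ediam_wordSet_le hq₀ i (hN.trans h)
    · simp

/-! ### Orders at infinity and conclusion -/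

theorem eventually_order_nonneg {ψ : ℕ → ℝ} (hψ : ∀ q : ℕ, 1 ≤ q → ψ q ∈ Ioc (0 : ℝ) 1) :
    ∀ᶠ q : ℕ in atTop, (0 : EReal) ≤ ((-(Real.log (ψ q) / Real.log (q : ℝ)) : ℝ) : EReal) := by
  filter_upwards [eventually_ge_atTop 1] with q hq
  have h1 : Real.log (ψ q) ≤ 0 := Real.log_nonpos (hψ q hq).1.le (hψ q hq).2
  have h2 : 0 ≤ Real.log (q : ℝ) := Real.log_nonneg (by exact_mod_cast hq)
  exact_mod_cast neg_nonneg.2 (div_nonpos_of_nonpos_of_nonneg h1 h2)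

theorem lowerOrder_nonneg {ψ : ℕ → ℝ} (hψ : ∀ q : ℕ, 1 ≤ q → ψ q ∈ Ioc (0 : ℝ) 1) :
    0 ≤ lowerOrder ψ :=
  le_liminf_of_le (by isBoundedDefault) (eventually_order_nonneg hψ)

theorem upperOrder_nonneg {ψ : ℕ → ℝ} (hψ : ∀ q : ℕ, 1 ≤ q → ψ q ∈ Ioc (0 : ℝ) 1) :
    0 ≤ upperOrder ψ :=
  le_limsup_of_frequently_le' (eventually_order_nonneg hψ).frequently

theorem eventually_rpow_lt_of_upperOrder_lt {ψ : ℕ → ℝ}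
    (hψ : ∀ q : ℕ, 1 ≤ q → ψ q ∈ Ioc (0 : ℝ) 1) {τ : ℝ} (h : upperOrder ψ < τ) :
    ∀ᶠ q : ℕ in atTop, (q : ℝ) ^ (-τ) < ψ q := by
  filter_upwards [eventually_lt_of_limsup_lt h, eventually_ge_atTop 2] with q hq hq2
  have hq' : -(Real.log (ψ q) / Real.log (q : ℝ)) < τ := by exact_mod_cast hq
  have hq1 : (1 : ℝ) < q := by exact_mod_cast hq2
  have hlog := Real.log_pos hq1
  rw [neg_lt, lt_div_iff₀ hlog] at hq'
  rw [Real.rpow_def_of_pos (by linarith), ← Real.lt_log_iff_exp_lt (hψ q (by omega)).1]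
  linarith

theorem eventually_le_rpow_of_lt_lowerOrder {ψ : ℕ → ℝ}
    (hψ : ∀ q : ℕ, 1 ≤ q → ψ q ∈ Ioc (0 : ℝ) 1) {τ : ℝ} (h : τ < lowerOrder ψ) :
    ∀ᶠ q : ℕ in atTop, ψ q ≤ (q : ℝ) ^ (-τ) := by
  filter_upwards [eventually_lt_of_lt_liminf h, eventually_ge_atTop 2] with q hq hq2
  have hq' : τ < -(Real.log (ψ q) / Real.log (q : ℝ)) := by exact_mod_cast hq
  have hq1 : (1 : ℝ) < q := by exact_mod_cast hq2
  have hlog := Real.log_pos hq1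
  rw [lt_neg, div_lt_iff₀ hlog] at hq'
  rw [Real.rpow_def_of_pos (by linarith), ← Real.log_le_iff_le_exp (hψ q (by omega)).1]
  linarith

theorem EReal.exists_real_gt_of_lt_one_div {u : EReal} (hu : 0 ≤ u) {r : ℝ} (hr : 0 < r)
    (h : (r : EReal) < 1 / (1 + u)) : ∃ τ : ℝ, u < τ ∧ r * (1 + τ) < 1 := by
  induction u with
  | bot => simp at hu
  | top =>
    have : (r : EReal) < 0 := by
      have h1 : (1 : EReal) + ⊤ = ⊤ := EReal.add_top_of_ne_bot (EReal.coe_ne_bot 1)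
      rwa [h1, EReal.div_top] at h
    exact absurd this (not_lt.2 (by exact_mod_cast hr.le))
  | coe u =>
    have hu' : 0 ≤ u := by exact_mod_cast hu
    have h' : r < 1 / (1 + u) := by
      rw [← EReal.coe_lt_coe_iff, EReal.coe_div]
      exact_mod_cast h
    have h2 : u < 1 / r - 1 := by
      rw [lt_sub_iff_add_lt, lt_div_iff₀ hr]
      rw [lt_div_iff₀ (by linarith)] at h'
      linarith
    obtain ⟨τ, h3, h4⟩ := exists_between h2
    refine ⟨τ, by exact_mod_cast h3, ?_⟩
    rw [lt_sub_iff_add_lt, lt_div_iff₀ hr] at h4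
    linarith

theorem EReal.exists_real_lt_of_one_div_lt {l : EReal} (hl : 0 ≤ l) {r : ℝ} (hr : 0 < r)
    (h : 1 / (1 + l) < (r : EReal)) : ∃ τ : ℝ, τ < l ∧ 1 < r * (1 + τ) := by
  have h2 : ((1 / r - 1 : ℝ) : EReal) < l := by
    induction l with
    | bot => simp at hl
    | top => exact EReal.coe_lt_top _
    | coe l =>
      have hl' : 0 ≤ l := by exact_mod_cast hl
      have h' : 1 / (1 + l) < r := by
        rw [← EReal.coe_lt_coe_iff, EReal.coe_div]
        exact_mod_cast h
      rw [EReal.coe_lt_coe_iff, sub_lt_iff_lt_add, div_lt_iff₀ hr]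
      rw [div_lt_iff₀ (by linarith)] at h'
      linarith
  obtain ⟨τ, h3, h4⟩ := EReal.lt_iff_exists_real_btwn.1 h2
  refine ⟨τ, h4, ?_⟩
  have h5 : 1 / r - 1 < τ := by exact_mod_cast h3
  rw [sub_lt_iff_lt_add, div_lt_iff₀ hr] at h5
  linarith

theorem theorem3 (ψ : ℕ → ℝ) (hψ : ∀ q : ℕ, 1 ≤ q → ψ q ∈ Set.Ioc (0 : ℝ) 1) :
    1 / (1 + upperOrder ψ) ≤ ((dimH (lurothWellApproximable ψ) : ENNReal) : EReal) ∧
      ((dimH (lurothWellApproximable ψ) : ENNReal) : EReal) ≤ 1 / (1 + lowerOrder ψ) := by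
  constructor
  · by_contra! hlt
    -- A real exponent strictly between the two sides leaves room for a real `τ` strictly above the
    -- upper order, even though the bounds are extended reals.
    obtain ⟨r, h1, h2⟩ := EReal.lt_iff_exists_real_btwn.1 hlt
    have hr : 0 < r := by exact_mod_cast (EReal.coe_ennreal_nonneg _).trans_lt h1
    obtain ⟨τ, hτ, hrτ⟩ := EReal.exists_real_gt_of_lt_one_div (upperOrder_nonneg hψ) hr h2
    have hτ0 : 0 ≤ τ := by exact_mod_cast (upperOrder_nonneg hψ).trans hτ.le
    lift r to NNReal using hr.le
    have h := le_dimH_lurothWellApproximable hτ0 (eventually_rpow_lt_of_upperOrder_lt hψ hτ)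
      (by exact_mod_cast hr) hrτ
    exact absurd (EReal.coe_ennreal_le_coe_ennreal_iff.2 h) (not_le.2 h1)
  · by_contra! hlt
    obtain ⟨r, h1, h2⟩ := EReal.lt_iff_exists_real_btwn.1 hlt
    have hl := lowerOrder_nonneg hψ
    have hr : 0 < r := by
      have h0 : (0 : EReal) ≤ 1 / (1 + lowerOrder ψ) :=
        EReal.div_nonneg zero_le_one (add_nonneg zero_le_one hl)
      exact_mod_cast h0.trans_lt h1
    obtain ⟨τ, hτ, hrτ⟩ := EReal.exists_real_lt_of_one_div_lt hl hr h1
    lift r to NNReal using hr.le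
    have h := dimH_lurothWellApproximable_le (eventually_le_rpow_of_lt_lowerOrder hψ hτ)
      (by exact_mod_cast hr) hrτ
    exact absurd (EReal.coe_ennreal_le_coe_ennreal_iff.2 h) (not_le.2 h2)
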